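/- For graphs $G$ and $H$, the corona product $G\circ H$ consists of one copy of $G$ and $|V(G)|$ copies of $H$, where the $i$-th vertex of $G$ is joined by an edge to every vertex of the $i$-th copy of $H$. Let $q\ge 2$ be an integer, let $C_q(0)=K_q$ be the complete graph on $q$ vertices, and let $C_q(g+1)=C_q(g)\circ K_q$ for $g\ge 0$. For vertices $u,v$ of a connected finite graph, let $r(u,v)$ be the effective resistance between $u$ and $v$ when every edge is replaced by a unit resistor, that is, the potential difference between $u$ and $v$ when a unit current enters the network at $u$ and leaves it at $v$. Then, for every integer $g\ge 0$, the effective resistance between any two vertices of $C_q(g)$ is well defined, and the Kirchhoff index of $C_q(g)$, the sum of $r(u,v)$ over all unordered pairs $\{u,v\}$ of distinct vertices, is $$R_{\mathrm{Kr}}(C_q(g))=\bigl(q^3(2g+1)-2q-1\bigr)(q+1)^{2g-2}+q(q+1)^{g-1}.$$ -/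

import Mathlib

/-- The corona product `G ∘ H`: one copy of `G` (the vertices `inl i`) and, for every vertex `i` of
`G`, one copy of `H` (the vertices `inr (i, a)`), all of whose vertices are joined to `i`. -/
def coronaProduct {V W : Type*} (G : SimpleGraph V) (H : SimpleGraph W) :
    SimpleGraph (V ⊕ V × W) where
  Adj
    | .inl i, .inl j => G.Adj i j
    | .inl i, .inr (j, _) => i = j
    | .inr (i, _), .inl j => i = j
    | .inr (i, a), .inr (j, b) => i = j ∧ H.Adj a b
  symm := ⟨by
    rintro (i | ⟨i, a⟩) (j | ⟨j, b⟩) h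
    · exact G.adj_symm h
    · exact Eq.symm h
    · exact Eq.symm h
    · exact ⟨h.1.symm, H.adj_symm h.2⟩⟩
  loopless := ⟨by
    rintro (i | ⟨i, a⟩) h
    · exact G.loopless.irrefl i h
    · exact H.loopless.irrefl a h.2⟩

/-- The vertex set of the recursive corona graph `C_q(g)`. -/
def RecursiveCoronaVertex (q : ℕ) : ℕ → Type
  | 0 => Fin q
  | g + 1 => RecursiveCoronaVertex q g ⊕ RecursiveCoronaVertex q g × Fin q

instance RecursiveCoronaVertex.instFintype (q : ℕ) :
    (g : ℕ) → Fintype (RecursiveCoronaVertex q g)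
  | 0 => inferInstanceAs (Fintype (Fin q))
  | g + 1 =>
    letI := RecursiveCoronaVertex.instFintype q g
    inferInstanceAs (Fintype (RecursiveCoronaVertex q g ⊕ RecursiveCoronaVertex q g × Fin q))

/-- The recursive corona graph: `C_q(0) = K_q` and `C_q(g+1) = C_q(g) ∘ K_q`. -/
def recursiveCorona (q : ℕ) : (g : ℕ) → SimpleGraph (RecursiveCoronaVertex q g)
  | 0 => (⊤ : SimpleGraph (Fin q))
  | g + 1 => coronaProduct (recursiveCorona q g) (⊤ : SimpleGraph (Fin q))

open Classical in
/-- `r` is an effective resistance between `u` and `v` in the electrical network obtained from `G`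
by replacing each edge by a unit resistor: when a unit current enters at `u` and leaves at `v`,
there is a potential `f` (obeying Ohm's law on the edges and Kirchhoff's current law at the
vertices) whose difference between `u` and `v` is `r`. -/
def IsEffectiveResistance {V : Type*} [Fintype V] (G : SimpleGraph V) (u v : V) (r : ℝ) : Prop :=
  ∃ f : V → ℝ,
    (∀ x, ∑ y with G.Adj x y, (f x - f y) = (if x = u then 1 else 0) - (if x = v then 1 else 0)) ∧
    f u - f v = r

theorem IsEffectiveResistance.symm {V : Type*} [Fintype V] {G : SimpleGraph V} {u v : V} {r : ℝ}
    (h : IsEffectiveResistance G u v r) : IsEffectiveResistance G v u r := by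
  obtain ⟨f, hf, hr⟩ := h
  refine ⟨fun x => -f x, fun x => ?_, by linarith⟩
  have := hf x
  rw [← neg_sub, ← this, ← Finset.sum_neg_distrib]
  exact Finset.sum_congr rfl fun y _ => by ring

/-- The effective resistance between `u` and `v` (a meaningless value if there is none, that is, if
`u` and `v` lie in different components). -/
noncomputable def effectiveResistance {V : Type*} [Fintype V] (G : SimpleGraph V) (u v : V) : ℝ :=
  Classical.epsilon fun r => IsEffectiveResistance G u v r

theorem effectiveResistance_comm {V : Type*} [Fintype V] (G : SimpleGraph V) (u v : V) :
    effectiveResistance G u v = effectiveResistance G v u := by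
  unfold effectiveResistance
  congr 1
  funext r
  exact propext ⟨IsEffectiveResistance.symm, IsEffectiveResistance.symm⟩

open Classical in
/-- The Kirchhoff index: the sum of the effective resistances over all unordered pairs of distinct
vertices. -/
noncomputable def kirchhoffIndex {V : Type*} [Fintype V] (G : SimpleGraph V) : ℝ :=
  ∑ e : Sym2 V with ¬ e.IsDiag,
    Sym2.lift ⟨effectiveResistance G, effectiveResistance_comm G⟩ e

open Classical in
/-- The graph Laplacian of `G` applied to `f`, evaluated at `x`. -/
noncomputable def netCurrent {V : Type*} [Fintype V] (G : SimpleGraph V) (f : V → ℝ) (x : V) : ℝ :=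
  ∑ y, if G.Adj x y then f x - f y else 0

open Classical in
theorem isEffectiveResistance_iff {V : Type*} [Fintype V] {G : SimpleGraph V} {u v : V} {r : ℝ} :
    IsEffectiveResistance G u v r ↔ ∃ f : V → ℝ,
      (∀ x, netCurrent G f x = (if x = u then 1 else 0) - (if x = v then 1 else 0)) ∧
        f u - f v = r := by
  simp only [IsEffectiveResistance, netCurrent, Finset.sum_filter]

/-- The Laplacian is symmetric. -/
theorem sum_mul_netCurrent_comm {V : Type*} [Fintype V] (G : SimpleGraph V) (f k : V → ℝ) :
    ∑ x, k x * netCurrent G f x = ∑ x, f x * netCurrent G k x := by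
  classical
  have expand (a b : V → ℝ) : ∑ x, a x * netCurrent G b x =
      (∑ x, ∑ y, if G.Adj x y then a x * b x else 0) -
        ∑ x, ∑ y, if G.Adj x y then a x * b y else 0 := by
    rw [← Finset.sum_sub_distrib]
    refine Finset.sum_congr rfl fun x _ => ?_
    rw [netCurrent, Finset.mul_sum, ← Finset.sum_sub_distrib]
    refine Finset.sum_congr rfl fun y _ => ?_
    split_ifs <;> ring
  rw [expand, expand]
  congr 1
  · simp only [mul_comm]
  · rw [Finset.sum_comm]
    simp only [G.adj_comm, mul_comm]

theorem IsEffectiveResistance.unique {V : Type*} [Fintype V] {G : SimpleGraph V} {u v : V}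
    {r s : ℝ} (hr : IsEffectiveResistance G u v r) (hs : IsEffectiveResistance G u v s) :
    r = s := by
  classical
  rw [isEffectiveResistance_iff] at hr hs
  obtain ⟨f, hf, rfl⟩ := hr
  obtain ⟨k, hk, rfl⟩ := hs
  have h := sum_mul_netCurrent_comm G k f
  simpa [hf, hk, mul_sub, Finset.sum_sub_distrib] using h

theorem IsEffectiveResistance.effectiveResistance_eq {V : Type*} [Fintype V] {G : SimpleGraph V}
    {u v : V} {r : ℝ} (h : IsEffectiveResistance G u v r) : effectiveResistance G u v = r :=
  IsEffectiveResistance.unique (Classical.epsilon_spec ⟨r, h⟩) h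

theorem effectiveResistance_self {V : Type*} [Fintype V] (G : SimpleGraph V) (u : V) :
    effectiveResistance G u u = 0 :=
  IsEffectiveResistance.effectiveResistance_eq
    (isEffectiveResistance_iff.2 ⟨0, fun x => by simp [netCurrent], by simp⟩)

open Classical in
/-- Summing a function on unordered pairs over all ordered pairs counts each pair twice. -/
theorem two_mul_sum_sym2_not_isDiag {V : Type*} [Fintype V] (p : Sym2 V → ℝ)
    (hp : ∀ v, p s(v, v) = 0) :
    2 * ∑ e : Sym2 V with ¬ e.IsDiag, p e = ∑ u, ∑ v, p s(u, v) := by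
  obtain ⟨S, hS⟩ : ∃ S, S = ∑ e : Sym2 V with ¬ e.IsDiag, p e := ⟨_, rfl⟩
  rw [← hS]
  let : LinearOrder V := LinearOrder.lift' (Fintype.equivFin V) (Fintype.equivFin V).injective
  have h := Finset.sum_sym2_filter_not_isDiag (Finset.univ : Finset V) p
  have hlt : S = ∑ u, ∑ v, if u < v then p s(u, v) else 0 := by
    rw [hS, ← Fintype.sum_prod_type' (f := fun u v => if u < v then p s(u, v) else 0),
      ← Finset.sum_filter]
    have hfilter : ({x : V × V | x.1 < x.2} : Finset (V × V)) =
        {x ∈ (Finset.univ : Finset V).offDiag | x.1 < x.2} := by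
      ext ⟨u, v⟩
      simpa using ne_of_lt
    rw [Finset.sym2_univ] at h
    rw [hfilter, ← h]
    congr!
  have hgt : S = ∑ u, ∑ v, if v < u then p s(u, v) else 0 := by
    rw [hlt, Finset.sum_comm]
    simp only [Sym2.eq_swap]
  rw [two_mul]
  nth_rewrite 1 [hlt]
  rw [hgt, ← Finset.sum_add_distrib]
  refine Finset.sum_congr rfl fun u _ => ?_
  rw [← Finset.sum_add_distrib]
  refine Finset.sum_congr rfl fun v _ => ?_
  rcases lt_trichotomy u v with huv | rfl | huv
  · simp [huv, huv.not_gt]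
  · simp [hp]
  · simp [huv, huv.not_gt]

theorem two_mul_kirchhoffIndex {V : Type*} [Fintype V] (G : SimpleGraph V) :
    2 * kirchhoffIndex G = ∑ u, ∑ v, effectiveResistance G u v := by
  rw [kirchhoffIndex, two_mul_sum_sym2_not_isDiag _ fun v => ?_]
  · rfl
  · exact effectiveResistance_self G v

theorem netCurrent_top {W : Type*} [Fintype W] (f : W → ℝ) (x : W) :
    netCurrent ⊤ f x = Fintype.card W * f x - ∑ y, f y := by
  classical
  rw [netCurrent, ← nsmul_eq_mul, ← Finset.card_univ, ← Finset.sum_const,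
    ← Finset.sum_sub_distrib]
  refine Finset.sum_congr rfl fun y _ => ?_
  by_cases h : x = y <;> simp [h]

open Classical in
theorem isEffectiveResistance_top {W : Type*} [Fintype W] (u v : W) :
    IsEffectiveResistance (⊤ : SimpleGraph W) u v
      (2 / Fintype.card W * (1 - if u = v then 1 else 0)) := by
  have hW : (Fintype.card W : ℝ) ≠ 0 := by
    have : Nonempty W := ⟨u⟩
    exact_mod_cast Fintype.card_ne_zero
  rw [isEffectiveResistance_iff]
  refine ⟨fun x => ((if x = u then 1 else 0) - if x = v then 1 else 0) / Fintype.card W,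
    fun x => ?_, ?_⟩
  · rw [netCurrent_top, ← Finset.sum_div]
    simp only [Finset.sum_sub_distrib, Finset.sum_ite_eq', Finset.mem_univ, if_true]
    field_simp
    ring
  · by_cases h : u = v
    · simp [h]
    · simp [h, Ne.symm h]
      ring

theorem kirchhoffIndex_top {W : Type*} [Fintype W] [Nonempty W] :
    kirchhoffIndex (⊤ : SimpleGraph W) = Fintype.card W - 1 := by
  classical
  have hW : (Fintype.card W : ℝ) ≠ 0 := by exact_mod_cast Fintype.card_ne_zero
  have h := two_mul_kirchhoffIndex (⊤ : SimpleGraph W)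
  simp only [(isEffectiveResistance_top _ _).effectiveResistance_eq, ← Finset.mul_sum,
    Finset.sum_sub_distrib, Finset.sum_ite_eq, Finset.mem_univ, if_true, Finset.sum_const,
    Finset.card_univ, nsmul_eq_mul, mul_one] at h
  field_simp at h
  linarith

/-- The vertex of `G` to which a vertex of the corona product is attached. -/
def coronaBase {V W : Type*} : V ⊕ V × W → V
  | .inl i => i
  | .inr (i, _) => i

@[simp]
theorem coronaBase_inl {V W : Type*} (i : V) : coronaBase (.inl i : V ⊕ V × W) = i := rfl

@[simp]
theorem coronaBase_inr {V W : Type*} (x : V × W) : coronaBase (.inr x : V ⊕ V × W) = x.1 := rfl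

section CoronaAdj

variable {V W : Type*} (G : SimpleGraph V) (H : SimpleGraph W) (i j : V) (x y : V × W)

@[simp]
theorem coronaProduct_adj_inl_inl : (coronaProduct G H).Adj (.inl i) (.inl j) ↔ G.Adj i j :=
  Iff.rfl

@[simp]
theorem coronaProduct_adj_inl_inr : (coronaProduct G H).Adj (.inl i) (.inr y) ↔ i = y.1 :=
  Iff.rfl

@[simp]
theorem coronaProduct_adj_inr_inl : (coronaProduct G H).Adj (.inr x) (.inl j) ↔ x.1 = j :=
  Iff.rfl

@[simp]
theorem coronaProduct_adj_inr_inr :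
    (coronaProduct G H).Adj (.inr x) (.inr y) ↔ x.1 = y.1 ∧ H.Adj x.2 y.2 :=
  Iff.rfl

end CoronaAdj

open Classical in
/-- The potential in a corona product with a complete graph when a unit current enters at `u`
and leaves at the base vertex of `u`. -/
noncomputable def coronaPotential {V W : Type*} [Fintype W] : V ⊕ V × W → V ⊕ V × W → ℝ
  | .inr (i, a), .inr (j, b) =>
    if j = i then (1 + if b = a then 1 else 0) / (Fintype.card W + 1) else 0
  | _, _ => 0

section Corona

variable {V W : Type*} [Fintype V] [Fintype W] (G : SimpleGraph V)

open Classical in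
theorem netCurrent_corona_inl (H : SimpleGraph W) (f : V ⊕ V × W → ℝ) (i : V) :
    netCurrent (coronaProduct G H) f (.inl i) =
      netCurrent G (fun j => f (.inl j)) i + ∑ b, (f (.inl i) - f (.inr (i, b))) := by
  simp only [netCurrent, Fintype.sum_sum_type, Fintype.sum_prod_type, coronaProduct_adj_inl_inl,
    coronaProduct_adj_inl_inr]
  congr 1
  rw [Finset.sum_comm]
  simp

open Classical in
theorem netCurrent_corona_inr (H : SimpleGraph W) (f : V ⊕ V × W → ℝ) (i : V) (a : W) :
    netCurrent (coronaProduct G H) f (.inr (i, a)) =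
      netCurrent H (fun b => f (.inr (i, b))) a + (f (.inr (i, a)) - f (.inl i)) := by
  simp only [netCurrent, Fintype.sum_sum_type, Fintype.sum_prod_type, coronaProduct_adj_inr_inl,
    coronaProduct_adj_inr_inr]
  rw [add_comm]
  congr 1
  · rw [Finset.sum_comm]
    simp [ite_and]
  · simp

open Classical in
theorem netCurrent_comp_coronaBase (H : SimpleGraph W) (f : V → ℝ) (x : V ⊕ V × W) :
    netCurrent (coronaProduct G H) (fun y => f (coronaBase y)) x =
      if x = .inl (coronaBase x) then netCurrent G f (coronaBase x) else 0 := by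
  obtain i | ⟨i, a⟩ := x
  · simp [netCurrent_corona_inl]
  · rw [netCurrent_corona_inr]
    simp [netCurrent]

open Classical in
theorem netCurrent_coronaPotential (u x : V ⊕ V × W) :
    netCurrent (coronaProduct G ⊤) (coronaPotential u) x =
      (if x = u then 1 else 0) - if x = .inl (coronaBase u) then 1 else 0 := by
  have hW : (Fintype.card W + 1 : ℝ) ≠ 0 := by positivity
  obtain i | ⟨i, a⟩ := u
  · by_cases h : x = .inl i <;> simp [coronaPotential, netCurrent, h]
  · obtain j | ⟨j, b⟩ := x
    · rw [netCurrent_corona_inl]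
      by_cases h : j = i
      · simp [coronaPotential, netCurrent, h, ← Finset.sum_div, Finset.sum_add_distrib,
          div_self hW]
      · simp [coronaPotential, netCurrent, h]
    · rw [netCurrent_corona_inr, netCurrent_top]
      by_cases h : j = i
      · simp [coronaPotential, h, ← Finset.sum_div, Finset.sum_add_distrib]
        field_simp
        ring
      · simp [coronaPotential, h]

theorem netCurrent_add (f k : V → ℝ) (x : V) :
    netCurrent G (f + k) x = netCurrent G f x + netCurrent G k x := by
  classical
  simp only [netCurrent, ← Finset.sum_add_distrib, Pi.add_apply]
  refine Finset.sum_congr rfl fun y _ => ?_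
  split_ifs <;> ring

theorem netCurrent_sub (f k : V → ℝ) (x : V) :
    netCurrent G (f - k) x = netCurrent G f x - netCurrent G k x := by
  rw [eq_sub_iff_add_eq, ← netCurrent_add, sub_add_cancel]

variable {G}

theorem IsEffectiveResistance.corona {u v : V ⊕ V × W} {r : ℝ}
    (h : IsEffectiveResistance G (coronaBase u) (coronaBase v) r) :
    IsEffectiveResistance (coronaProduct G (⊤ : SimpleGraph W)) u v
      (r + (coronaPotential u u - coronaPotential u v) +
        (coronaPotential v v - coronaPotential v u)) := by
  classical
  rw [isEffectiveResistance_iff] at h ⊢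
  obtain ⟨f, hf, rfl⟩ := h
  refine ⟨(fun y => f (coronaBase y)) + coronaPotential u - coronaPotential v, fun x => ?_, ?_⟩
  · rw [netCurrent_sub, netCurrent_add, netCurrent_comp_coronaBase, netCurrent_coronaPotential,
      netCurrent_coronaPotential, hf]
    obtain i | ⟨i, a⟩ := x
    · simp only [coronaBase_inl, Sum.inl.injEq, if_true]
      grind
    · simp only [reduceCtorEq, if_false]
      grind
  · simp only [Pi.add_apply, Pi.sub_apply]
    ring

theorem sum_coronaPotential_self :
    ∑ u : V ⊕ V × W, coronaPotential u u =
      Fintype.card V * (Fintype.card W * (2 / (Fintype.card W + 1))) := by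
  simp [coronaPotential, mul_assoc]
  norm_num

theorem sum_coronaPotential :
    ∑ u : V ⊕ V × W, ∑ v, coronaPotential u v = (Fintype.card V * Fintype.card W : ℝ) := by
  classical
  have hW : (Fintype.card W + 1 : ℝ) ≠ 0 := by positivity
  have inner (i : V) (a : W) : ∑ v, coronaPotential (.inr (i, a)) v = 1 := by
    rw [Fintype.sum_sum_type, Fintype.sum_prod_type, Finset.sum_comm]
    simp [coronaPotential, ← Finset.sum_div, Finset.sum_add_distrib, div_self hW]
  have inner_inl (i : V) : ∑ v : V ⊕ V × W, coronaPotential (.inl i) v = 0 := by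
    simp [coronaPotential]
  simp only [Fintype.sum_sum_type (f := fun u => ∑ v, coronaPotential u v),
    inner, inner_inl]
  simp

theorem sum_comp_coronaBase (f : V → ℝ) :
    ∑ u : V ⊕ V × W, f (coronaBase u) = (Fintype.card W + 1) * ∑ i, f i := by
  simp only [Fintype.sum_sum_type, Fintype.sum_prod_type, coronaBase, Finset.sum_const,
    Finset.card_univ, nsmul_eq_mul, ← Finset.mul_sum]
  ring

theorem kirchhoffIndex_corona (h : ∀ i j, ∃ r, IsEffectiveResistance G i j r) :
    kirchhoffIndex (coronaProduct G (⊤ : SimpleGraph W)) =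
      (Fintype.card W + 1) ^ 2 * kirchhoffIndex G +
        2 * Fintype.card W * Fintype.card V ^ 2 - Fintype.card W * Fintype.card V := by
  have hW : (Fintype.card W + 1 : ℝ) ≠ 0 := by positivity
  have hG (i j : V) : IsEffectiveResistance G i j (effectiveResistance G i j) :=
    Classical.epsilon_spec (h i j)
  have hsum := two_mul_kirchhoffIndex (coronaProduct G (⊤ : SimpleGraph W))
  have hbase : ∑ u : V ⊕ V × W, ∑ v : V ⊕ V × W,
      effectiveResistance G (coronaBase u) (coronaBase v) =
        (Fintype.card W + 1) ^ 2 * (2 * kirchhoffIndex G) := by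
    simp only [sum_comp_coronaBase]
    rw [sum_comp_coronaBase (fun i => (Fintype.card W + 1 : ℝ) * ∑ j, effectiveResistance G i j),
      ← Finset.mul_sum, two_mul_kirchhoffIndex]
    ring
  simp only [(hG _ _).corona.effectiveResistance_eq, Finset.sum_add_distrib,
    Finset.sum_sub_distrib, hbase] at hsum
  rw [Finset.sum_comm (f := fun u v : V ⊕ V × W => coronaPotential v u)] at hsum
  simp only [Finset.sum_const, Finset.card_univ, nsmul_eq_mul, ← Finset.mul_sum,
    sum_coronaPotential_self, sum_coronaPotential, Fintype.card_sum, Fintype.card_prod,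
    Nat.cast_add, Nat.cast_mul] at hsum
  refine mul_left_cancel₀ (mul_ne_zero two_ne_zero hW) ?_
  field_simp at hsum
  linarith

end Corona

theorem card_recursiveCoronaVertex (q g : ℕ) :
    Fintype.card (RecursiveCoronaVertex q g) = q * (q + 1) ^ g := by
  induction g with
  | zero => exact (Fintype.card_fin q).trans (by simp)
  | succ g ih =>
    have : Fintype.card (RecursiveCoronaVertex q (g + 1)) =
        Fintype.card (RecursiveCoronaVertex q g ⊕ RecursiveCoronaVertex q g × Fin q) := rfl
    rw [this, Fintype.card_sum, Fintype.card_prod, ih, Fintype.card_fin]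
    ring

theorem exists_isEffectiveResistance_recursiveCorona (q g : ℕ) :
    ∀ u v, ∃ r, IsEffectiveResistance (recursiveCorona q g) u v r := by
  induction g with
  | zero => exact fun u v => ⟨_, isEffectiveResistance_top (W := Fin q) u v⟩
  | succ g ih =>
    intro u v
    obtain ⟨r, hr⟩ := ih (coronaBase u) (coronaBase v)
    exact ⟨_, hr.corona (W := Fin q)⟩

theorem mainTheorem2 (q : ℕ) (hq : 2 ≤ q) (g : ℕ) :
    (∀ u v : RecursiveCoronaVertex q g,
      ∃! r : ℝ, IsEffectiveResistance (recursiveCorona q g) u v r) ∧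
    kirchhoffIndex (recursiveCorona q g) =
      ((q : ℝ) ^ 3 * (2 * (g : ℝ) + 1) - 2 * (q : ℝ) - 1) * ((q : ℝ) + 1) ^ (2 * (g : ℤ) - 2) +
        (q : ℝ) * ((q : ℝ) + 1) ^ ((g : ℤ) - 1) := by
  refine ⟨fun u v => ?_, ?_⟩
  · obtain ⟨r, hr⟩ := exists_isEffectiveResistance_recursiveCorona q g u v
    exact ⟨r, hr, fun s hs => hs.unique hr⟩
  have hq1 : (q + 1 : ℝ) ≠ 0 := by positivity
  rw [zpow_sub₀ hq1, zpow_sub₀ hq1, mul_comm (2 : ℤ), zpow_mul, zpow_natCast]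
  norm_cast
  push_cast
  induction g with
  | zero =>
    have : Nonempty (Fin q) := ⟨⟨0, by omega⟩⟩
    have h := kirchhoffIndex_top (W := Fin q)
    rw [Fintype.card_fin] at h
    refine h.trans ?_
    field_simp
    push_cast
    ring
  | succ g ih =>
    have h := kirchhoffIndex_corona (W := Fin q) (exists_isEffectiveResistance_recursiveCorona q g)
    rw [Fintype.card_fin, card_recursiveCoronaVertex, ih] at h
    refine h.trans ?_
    push_cast
    field_simp
    ring
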